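/- Let $k,r,N$ be integers with $1\le r\le k$ and $N\ge k-r$. Write $\left[{N\atop m}\right]_q$ for the Gaussian binomial coefficient, which is $0$ unless $0\le m\le N$. A $(k-1)$-color partition of $n$ is a pair $(\alpha,c)$, where $\alpha=(\alpha_1\ge\alpha_2\ge\dots\ge\alpha_l\ge 1)$ is a partition of $n$ and $c$ assigns to each $i\in\{1,\dots,l\}$ a color $c(i)\in\{1,\dots,k-1\}$ so that $c(i)\le c(i+1)$ whenever $\alpha_i=\alpha_{i+1}$. (For $n=0$ there is exactly the empty one; for $k=1$ the set of colors is empty and only the empty one exists.) Let $C_n(2k+1,r)$ be the set of $(k-1)$-color partitions of $n$ satisfying: (i) for $1\le i\le l$, $\alpha_i>|2c(i)-r+1|$ if $\alpha_i\equiv r \pmod 2$, and $\alpha_i>|2c(i)-r|$ otherwise; (ii) for $1\le i<l$, $$\alpha_i-\alpha_{i+1}\ \ge\ \begin{cases}2+|2(c(i)-c(i+1))| & \text{if }\alpha_i\equiv\alpha_{i+1}\pmod 2,\\ 2+|2(c(i)-c(i+1))-1| & \text{if }\alpha_i\not\equiv\alpha_{i+1}\equiv r\pmod 2,\\ 2+|2(c(i)-c(i+1))+1|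 & \text{if }\alpha_{i+1}\not\equiv\alpha_i\equiv r\pmod 2.\end{cases}$$ Then $$\sum_{j=-\infty}^{\infty}(-1)^j q^{\,j((2k+1)j+2k+1-2r)/2}\left[{N\atop \left\lfloor\frac{N-k+r-(2k+1)j}{2}\right\rfloor}\right]_q\ =\ \sum_{n\ge 0}D_n\,q^n,$$ where $D_n$ is the number of $(\alpha,c)\in C_n(2k+1,r)$ that, if nonempty, satisfy (iv) $\displaystyle (N-1)-\alpha_1\ \ge\ \begin{cases}\left|2c(1)-k+\tfrac12\right|-\tfrac12 & \text{if }N+k\equiv r\pmod 2,\\[2pt] \left|2c(1)-k-\tfrac12\right|-\tfrac12 & \text{otherwise.}\end{cases}$ In particular, every nonempty colored partition counted on the right satisfies $\alpha_1\le N-1$. -/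

import Mathlib

open Polynomial
open scoped PowerSeries

namespace MultiColor

/-! ### Gaussian binomial coefficients -/

/-- The Gaussian binomial coefficient `[n choose m]_q` for `n m : ℕ`, as a polynomial in `q = X`,
through the `q`-Pascal recursion. See `gauss_mul_qPoch` for the usual quotient formula. -/
noncomputable def gauss : ℕ → ℕ → ℤ[X]
  | _, 0 => 1
  | 0, _ + 1 => 0
  | n + 1, m + 1 => gauss n m + X ^ (m + 1) * gauss n (m + 1)

/-- `(q)_n = (1 - q)(1 - q ^ 2) ⋯ (1 - q ^ n)`. -/
noncomputable def qPoch (n : ℕ) : ℤ[X] := ∏ i ∈ Finset.range n, (1 - X ^ (i + 1))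

theorem gauss_eq_zero_of_lt : ∀ (n m : ℕ), n < m → gauss n m = 0
  | _, 0, h => absurd h (Nat.not_lt_zero _)
  | 0, _ + 1, _ => by simp [gauss]
  | n + 1, m + 1, h => by
      rw [gauss, gauss_eq_zero_of_lt n m (by omega), gauss_eq_zero_of_lt n (m + 1) (by omega)]
      simp

theorem gauss_self : ∀ n : ℕ, gauss n n = 1
  | 0 => by simp [gauss]
  | n + 1 => by rw [gauss, gauss_self n, gauss_eq_zero_of_lt n (n + 1) (by omega)]; simp

/-- `[a+b choose a]_q (q)_a (q)_b = (q)_{a+b}`: the recursion gives the usual quotient. -/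
theorem gauss_mul_qPoch : ∀ a b : ℕ, gauss (a + b) a * (qPoch a * qPoch b) = qPoch (a + b)
  | 0, b => by simp [gauss, qPoch]
  | a + 1, 0 => by simp [gauss_self, qPoch]
  | a + 1, b + 1 => by
      have h1 := gauss_mul_qPoch a (b + 1)
      have h2 := gauss_mul_qPoch (a + 1) b
      have e : a + 1 + (b + 1) = (a + (b + 1)) + 1 := by omega
      have e2 : a + 1 + b = a + (b + 1) := by omega
      have s : ∀ n, qPoch (n + 1) = qPoch n * (1 - X ^ (n + 1)) := fun n => by
        simp [qPoch, Finset.prod_range_succ]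
      rw [e2] at h2
      rw [e, gauss, s (a + (b + 1))]
      rw [s b] at h1 ⊢
      rw [s a] at h2 ⊢
      linear_combination (1 - X ^ (a + 1)) * h1 + X ^ (a + 1) * (1 - X ^ (b + 1)) * h2

/-- `[N choose m]_q` for an arbitrary integer `m`; it is `0` unless `0 ≤ m ≤ N`. -/
noncomputable def gaussInt (N : ℕ) (m : ℤ) : ℤ[X] := if 0 ≤ m then gauss N m.toNat else 0

/-! ### The finitized bosonic sum for the odd modulus `2k+1` -/

/-- The exponent `j((2k+1)j + 2k+1 - 2r)/2` of `q`; the division is exact (`two_dvd_expo`). -/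
def expo (k r : ℕ) (j : ℤ) : ℤ := j * ((2 * k + 1) * j + 2 * k + 1 - 2 * r) / 2

theorem two_dvd_expo (k r : ℕ) (j : ℤ) : (2 : ℤ) ∣ j * ((2 * k + 1) * j + 2 * k + 1 - 2 * r) := by
  have h : (2 : ℤ) ∣ j * (j + 1) := (Int.even_mul_succ_self j).two_dvd
  have e : j * ((2 * k + 1) * j + 2 * k + 1 - 2 * r)
      = (2 * k + 1) * (j * (j + 1)) - 2 * (j * r) := by ring
  rw [e]
  exact dvd_sub (h.mul_left _) (dvd_mul_right _ _)

theorem expo_nonneg (k r : ℕ) (hrk : r ≤ k) (j : ℤ) : 0 ≤ expo k r j := by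
  have hr' : (r : ℤ) ≤ k := by exact_mod_cast hrk
  have hr0 : (0 : ℤ) ≤ r := Int.natCast_nonneg r
  refine Int.ediv_nonneg ?_ (by norm_num)
  rcases le_or_gt 0 j with h | h
  · exact mul_nonneg h (by nlinarith)
  · exact mul_nonneg_of_nonpos_of_nonpos h.le (by nlinarith)

/-- The term of index `j` of the finitized bosonic sum. The exponent is a nonnegative integer for
`r ≤ k` (`expo_nonneg`), and the integer division `/ 2` in the Gaussian binomial is the floor. -/
noncomputable def bosonicTerm (k r N : ℕ) (j : ℤ) : ℤ[X] :=
  C (j.negOnePow : ℤ) * X ^ (expo k r j).toNat *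
    gaussInt N (((N : ℤ) - k + r - (2 * k + 1) * j) / 2)

theorem bosonicTerm_support_finite (k r N : ℕ) :
    (Function.support (bosonicTerm k r N)).Finite := by
  refine (Set.finite_Icc (-(N + k + r + 2 : ℤ)) (N + k + r + 2)).subset fun j hj => ?_
  by_contra hc
  refine hj ?_
  have hg : gaussInt N (((N : ℤ) - k + r - (2 * k + 1) * j) / 2) = 0 := by
    unfold gaussInt
    split_ifs with h
    · refine gauss_eq_zero_of_lt _ _ ?_
      have h0 : (0 : ℤ) ≤ k := Int.natCast_nonneg k
      have h1 : 0 ≤ (N : ℤ) - k + r - (2 * k + 1) * j := by omega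
      have h2 : j < -(N + k + r + 2 : ℤ) := by
        by_contra h3
        have h4 : (N + k + r + 2 : ℤ) < j := by
          by_contra h5
          exact hc ⟨by omega, by omega⟩
        nlinarith
      have h6 : (2 * k + 1) * j ≤ j := by nlinarith
      omega
    · rfl
  simp [bosonicTerm, hg]

/-- `∑_{j ∈ ℤ} (-1)^j q^{j((2k+1)j+2k+1-2r)/2} [N choose ⌊(N-k+r-(2k+1)j)/2⌋]_q`. Only finitely
many terms are nonzero (`bosonicTerm_support_finite`). -/
noncomputable def bosonicSum (k r N : ℕ) : ℤ[X] := ∑ᶠ j : ℤ, bosonicTerm k r N j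

/-! ### Colored partitions -/

/-- A `t`-color partition of `n`: the list of pairs `(α_i, c(i))`, where the parts `α_i` are
positive, nonincreasing, and sum to `n`, the colors lie in `{1, …, t}`, and
`c(i) ≤ c(i+1)` whenever `α_i = α_{i+1}`. -/
@[ext]
structure ColorPartition (t n : ℕ) where
  entries : List (ℕ × ℕ)
  part_pos : ∀ e ∈ entries, 0 < e.1
  color_mem : ∀ e ∈ entries, 1 ≤ e.2 ∧ e.2 ≤ t
  sum_parts : (entries.map Prod.fst).sum = n
  chain : entries.IsChain fun a b => b.1 ≤ a.1 ∧ (a.1 = b.1 → a.2 ≤ b.2)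

instance (t n : ℕ) : Finite (ColorPartition t n) := by
  have key : ∀ p : ColorPartition t n, ∀ e ∈ p.entries, e.1 < n + 1 ∧ e.2 < t + 1 := by
    intro p e he
    have h := List.single_le_sum (l := p.entries.map Prod.fst) (by simp) e.1
      (List.mem_map_of_mem he)
    rw [p.sum_parts] at h
    exact ⟨by omega, Nat.lt_succ_of_le (p.color_mem e he).2⟩
  have hlen : ∀ p : ColorPartition t n, p.entries.length ≤ n := by
    intro p
    have h := List.length_le_sum_of_one_le (p.entries.map Prod.fst) (by
      intro i hi
      obtain ⟨e, he, rfl⟩ := List.mem_map.1 hi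
      exact p.part_pos e he)
    rwa [p.sum_parts, List.length_map] at h
  have hfin : {l : List (Fin (n + 1) × Fin (t + 1)) | l.length ≤ n}.Finite :=
    List.finite_length_le _ n
  have hrange : (Set.range (ColorPartition.entries (t := t) (n := n))).Finite := by
    refine (hfin.image (List.map fun e => ((e.1 : ℕ), (e.2 : ℕ)))).subset ?_
    rintro _ ⟨p, rfl⟩
    refine ⟨p.entries.attach.map
      (fun e => (⟨e.1.1, (key p e.1 e.2).1⟩, ⟨e.1.2, (key p e.1 e.2).2⟩)), ?_, ?_⟩
    · simpa using hlen p
    · rw [List.map_map]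
      exact List.attach_map_subtype_val _
  have := hrange.to_subtype
  exact Finite.of_injective_finite_range (f := ColorPartition.entries (t := t) (n := n))
    fun p q h => ColorPartition.ext h

/-- Lower bound in the initial condition, for the part `e.1` of color `e.2`. -/
def initBound (r : ℕ) (e : ℕ × ℕ) : ℤ :=
  if e.1 ≡ r [MOD 2] then |2 * (e.2 : ℤ) - r + 1| else |2 * (e.2 : ℤ) - r|

/-- Lower bound in the color difference condition, for consecutive entries `a = (α_i, c(i))` and
`b = (α_{i+1}, c(i+1))`. -/
def diffBound (r : ℕ) (a b : ℕ × ℕ) : ℤ :=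
  if a.1 ≡ b.1 [MOD 2] then 2 + |2 * ((a.2 : ℤ) - b.2)|
  else if b.1 ≡ r [MOD 2] then 2 + |2 * ((a.2 : ℤ) - b.2) - 1|
  else 2 + |2 * ((a.2 : ℤ) - b.2) + 1|

/-- The set `C_n(M, r)` of `(k-1)`-color partitions of `n`, where `k = ⌊M/2⌋`, that satisfy the
initial conditions, the color difference conditions, and the parity condition on the last color
`k - 1` when `M` is even. -/
def colorSet (n M r : ℕ) : Set (ColorPartition (M / 2 - 1) n) :=
  {p | (∀ e ∈ p.entries, initBound r e < (e.1 : ℤ)) ∧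
    (p.entries.IsChain fun a b => diffBound r a b ≤ (a.1 : ℤ) - b.1) ∧
    (∀ e ∈ p.entries, Even M → e.2 = M / 2 - 1 → ¬ e.1 ≡ r [MOD 2])}

/-- The members of `C_n(2k+1, r)` whose first entry `(α_1, c(1))`, if there is one, satisfies
`N - 1 - α_1 ≥ |2c(1) - k + 1/2| - 1/2` if `N + k ≡ r (mod 2)`, and
`N - 1 - α_1 ≥ |2c(1) - k - 1/2| - 1/2` otherwise. -/
def boundedColorSet (n k r N : ℕ) : Set (ColorPartition ((2 * k + 1) / 2 - 1) n) :=
  {p | p ∈ colorSet n (2 * k + 1) r ∧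
    ∀ e ∈ p.entries.head?,
      (if N + k ≡ r [MOD 2] then |2 * (e.2 : ℚ) - k + 1 / 2| - 1 / 2
        else |2 * (e.2 : ℚ) - k - 1 / 2| - 1 / 2) ≤ ((N : ℚ) - 1) - e.1}

end MultiColor

namespace MultiColor

/-! ### Colored partitions as sequences of points in a strip -/

/-! Put a part α of color c at time α, at whichever of the heights 2c, 2c + 1 is congruent to α + r
+ 1 mod 2, and add a start point (-1, r). The parity cases of (i) and (ii) merge into one condition:
each point, moved back two units of time, lies in the forward cone of the next point of the list.
Condition (iv) says that the cone of the first point contains (N - 1, b), where b is k or k + 1.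

Let f(N, b) be the generating function of the lists whose first cone contains (N - 1, b), for 1 ≤ b
≤ 2k and b ≡ N + r mod 2. A cone containing (N, b) has its apex there, or contains (N - 1, b - 1) or
(N - 1, b + 1), and both of these exactly when it contains (N - 2, b). Hence f(N+1, b) = f(N, b-1) +
f(N, b+1) + (q^N - 1) f(N-1, b) for 2 ≤ b ≤ 2k - 1, by `ncard_reachSet_succ`. No part has height 1
or 2k, so f(N+1, 1) = f(N, 2) and f(N+1, 2k) = f(N, 2k-1). With f(0, b) = δ_{b,r} and f(-1, b) = 0
this determines f.

The bosonic sum extends to every b (`stripSum`): even j are translates and odd j reflections in the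
walls 0 and 2k + 1. It obeys the same recurrence term by term (`gaussInt_add_two`), and the same
wall identities because neighbouring terms cancel (`stripSum_one`, `stripSum_top`). Induction on N
concludes in `coeff_stripSum`. -/

/-- The height of an entry `(α, c)`: the number among `2c, 2c + 1` congruent to `α + r + 1`
modulo `2`. -/
def height (r : ℕ) (e : ℕ × ℕ) : ℤ := if e.1 ≡ r [MOD 2] then 2 * (e.2 : ℤ) + 1 else 2 * (e.2 : ℤ)

/-- The first point `(α₁, height)` of a list of entries; the empty list starts at `(-1, r)`. -/
def front (r : ℕ) : List (ℕ × ℕ) → ℤ × ℤ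
  | [] => (-1, r)
  | e :: _ => (e.1, height r e)

/-- The point `(N - 1, b)` is in the forward light cone of the first point of `l`. -/
def Reaches (r : ℕ) (N b : ℤ) (l : List (ℕ × ℕ)) : Prop :=
  (front r l).2 - b ≤ N - 1 - (front r l).1 ∧ b - (front r l).2 ≤ N - 1 - (front r l).1

/-- Lists of entries with colors in `{1, …, k - 1}`, where each entry, moved back by two units of
time, lies in the forward light cone of the following one. -/
def Admissible (k r : ℕ) : List (ℕ × ℕ) → Prop
  | [] => True
  | e :: l => (1 ≤ e.2 ∧ e.2 + 1 ≤ k) ∧ Reaches r (e.1 - 1) (height r e) l ∧ Admissible k r l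

/-- Admissible lists of total size `n` that reach `(N, b)`. -/
def reachSet (k r : ℕ) (N b : ℤ) (n : ℕ) : Set (List (ℕ × ℕ)) :=
  {l | Admissible k r l ∧ Reaches r N b l ∧ (l.map Prod.fst).sum = n}

theorem height_cases (r : ℕ) (e : ℕ × ℕ) :
    (e.1 % 2 = r % 2 ∧ height r e = 2 * (e.2 : ℤ) + 1) ∨
      (e.1 % 2 ≠ r % 2 ∧ height r e = 2 * (e.2 : ℤ)) := by
  unfold height
  split_ifs with h
  · exact Or.inl ⟨h, rfl⟩
  · exact Or.inr ⟨h, rfl⟩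

theorem front_parity (r : ℕ) (l : List (ℕ × ℕ)) :
    ((front r l).1 + (front r l).2) % 2 = ((r : ℤ) + 1) % 2 := by
  cases l with
  | nil => simp only [front]; omega
  | cons e l => have := height_cases r e; simp only [front]; omega

theorem neg_one_le_front (r : ℕ) (l : List (ℕ × ℕ)) : -1 ≤ (front r l).1 := by
  cases l <;> simp only [front] <;> omega

theorem Admissible.front_bounds {k r : ℕ} {l : List (ℕ × ℕ)} (h : Admissible k r l) :
    ((front r l).1 = -1 ∧ (front r l).2 = r) ∨
      (2 ≤ (front r l).2 ∧ (front r l).2 ≤ 2 * k - 1) := by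
  cases l with
  | nil => simp [front]
  | cons e l =>
    have := height_cases r e
    have := h.1
    simp only [front]
    omega

/-- Cones nest, so every point lies in the cone of the start point (-1, r). Thus (i) for the last
part and (ii) imply (i) for all parts. -/
theorem Admissible.start_le {k r : ℕ} : ∀ {l : List (ℕ × ℕ)}, Admissible k r l →
    (front r l).2 - r ≤ (front r l).1 + 1 ∧ r - (front r l).2 ≤ (front r l).1 + 1
  | [], _ => by simp [front]
  | e :: l, h => by
    have h1 := h.2.2.start_le
    have h2 := h.2.1
    simp only [Reaches] at h2
    simp only [front]
    omega

theorem Admissible.of_isChain {k r : ℕ} : ∀ {l : List (ℕ × ℕ)},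
    (∀ e ∈ l, 1 ≤ e.2 ∧ e.2 + 1 ≤ k) → (∀ e ∈ l, initBound r e < (e.1 : ℤ)) →
    (l.IsChain fun a b => diffBound r a b ≤ (a.1 : ℤ) - b.1) → Admissible k r l
  | [], _, _, _ => trivial
  | [e], hc, hi, _ => by
    refine ⟨hc e (by simp), ?_, trivial⟩
    have h := hi e (by simp)
    have h1 := height_cases r e
    unfold initBound at h
    simp only [Reaches, front]
    split_ifs at h <;> rw [abs_lt] at h <;> simp only [Nat.ModEq] at * <;> omega
  | e :: f :: l, hc, hi, hd => by
    rw [List.isChain_cons_cons] at hd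
    refine ⟨hc e (by simp), ?_, of_isChain (fun x hx => hc x (by simp_all))
      (fun x hx => hi x (by simp_all)) hd.2⟩
    have h := hd.1
    have h1 := height_cases r e
    have h2 := height_cases r f
    unfold diffBound at h
    simp only [Reaches, front]
    split_ifs at h <;> rw [← le_sub_iff_add_le', abs_le] at h <;>
      simp only [Nat.ModEq] at * <;> omega

/-- Consecutive parts differ by at least 2, so the parts strictly decrease and the color rule for
equal parts is vacuous. -/
theorem Admissible.properties {k r : ℕ} : ∀ {l : List (ℕ × ℕ)}, Admissible k r l →
    (∀ e ∈ l, (1 ≤ e.2 ∧ e.2 + 1 ≤ k) ∧ 0 < e.1 ∧ initBound r e < (e.1 : ℤ)) ∧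
    (l.IsChain fun a b => diffBound r a b ≤ (a.1 : ℤ) - b.1) ∧
    (l.IsChain fun a b => b.1 ≤ a.1 ∧ (a.1 = b.1 → a.2 ≤ b.2))
  | [], _ => by simp
  | e :: l, h => by
    have ih := h.2.2.properties
    have hs := h.start_le
    have h0 := neg_one_le_front r l
    have h1 := height_cases r e
    have h2 := h.2.1
    simp only [front] at hs
    refine ⟨?_, ?_⟩
    · intro x hx
      rcases List.mem_cons.1 hx with rfl | hx
      · have h3 := h.2.2.start_le
        simp only [Reaches] at h2
        refine ⟨h.1, by omega, ?_⟩
        unfold initBound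
        split_ifs <;> rw [abs_lt] <;> simp only [Nat.ModEq] at * <;> omega
      · exact ih.1 x hx
    · cases l with
      | nil => simp
      | cons f l =>
        have h3 := height_cases r f
        simp only [Reaches, front] at h2
        rw [List.isChain_cons_cons, List.isChain_cons_cons]
        refine ⟨⟨?_, ih.2.1⟩, ⟨?_, ih.2.2⟩⟩
        · unfold diffBound
          split_ifs <;> rw [← le_sub_iff_add_le', abs_le] <;> simp only [Nat.ModEq] at * <;> omega
        · omega

theorem finite_reachSet (k r : ℕ) (N b : ℤ) (n : ℕ) : (reachSet k r N b n).Finite := by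
  refine (Set.finite_range (ColorPartition.entries (t := k - 1) (n := n))).subset ?_
  rintro l ⟨ha, -, hs⟩
  have hp := ha.properties
  exact ⟨⟨l, fun e he => (hp.1 e he).2.1, fun e he => by have := (hp.1 e he).1; omega, hs,
    hp.2.2⟩, rfl⟩

/-! ### The bound on the largest part as a cone condition -/

/-- The height, `k` or `k + 1`, at which the bounded colored partitions end. -/
def endHeight (k r N : ℕ) : ℤ := if N + k ≡ r [MOD 2] then k else k + 1

theorem endHeight_cases (k r N : ℕ) :
    ((N + k) % 2 = r % 2 ∧ endHeight k r N = k) ∨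
      ((N + k) % 2 ≠ r % 2 ∧ endHeight k r N = k + 1) := by
  unfold endHeight
  split_ifs with h
  · exact Or.inl ⟨h, rfl⟩
  · exact Or.inr ⟨h, rfl⟩

/-- The halves in (iv) serve both possible heights 2c and 2c + 1: each integer bound is off by at
most one from the cone bound, and parity closes the gap. -/
theorem head_bound_iff (k r N : ℕ) (e : ℕ × ℕ) :
    (if N + k ≡ r [MOD 2] then |2 * (e.2 : ℚ) - k + 1 / 2| - 1 / 2
        else |2 * (e.2 : ℚ) - k - 1 / 2| - 1 / 2) ≤ ((N : ℚ) - 1) - e.1 ↔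
      height r e - endHeight k r N ≤ N - 1 - e.1 ∧
        endHeight k r N - height r e ≤ N - 1 - e.1 := by
  have h1 := height_cases r e
  have h2 := endHeight_cases k r N
  split_ifs with h
  · have key : |2 * (e.2 : ℚ) - k + 1 / 2| - 1 / 2 ≤ ((N : ℚ) - 1) - e.1 ↔
        2 * (e.2 : ℤ) - k ≤ N - 1 - e.1 ∧ (k : ℤ) - 1 - 2 * e.2 ≤ N - 1 - e.1 := by
      rw [sub_le_iff_le_add, abs_le, and_comm]
      qify
      constructor <;> rintro ⟨h3, h4⟩ <;> constructor <;> linarith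
    rw [key]
    unfold Nat.ModEq at h
    omega
  · have key : |2 * (e.2 : ℚ) - k - 1 / 2| - 1 / 2 ≤ ((N : ℚ) - 1) - e.1 ↔
        2 * (e.2 : ℤ) - k - 1 ≤ N - 1 - e.1 ∧ (k : ℤ) - 2 * e.2 ≤ N - 1 - e.1 := by
      rw [sub_le_iff_le_add, abs_le, and_comm]
      qify
      constructor <;> rintro ⟨h3, h4⟩ <;> constructor <;> linarith
    rw [key]
    unfold Nat.ModEq at h
    omega

theorem image_boundedColorSet (k r N n : ℕ) (hr : 0 < r) (hrk : r ≤ k) (hN : k ≤ N + r) :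
    ColorPartition.entries '' boundedColorSet n k r N = reachSet k r N (endHeight k r N) n := by
  have h2 := endHeight_cases k r N
  ext l
  constructor
  · rintro ⟨p, ⟨⟨hi, hd, -⟩, hh⟩, rfl⟩
    refine ⟨Admissible.of_isChain (fun e he => ?_) hi hd, ?_, p.sum_parts⟩
    · have := p.color_mem e he
      omega
    · match h : p.entries with
      -- The start point must reach the end: this needs N ≥ k - r, and N ≥ k + 1 - r when the end
      -- height is k + 1, which then follows by parity.
      | [] => simp only [Reaches, front]; omega
      | e :: l =>
        have := (head_bound_iff k r N e).1 (hh e (by simp [h]))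
        simpa only [Reaches, front] using this
  · rintro ⟨ha, hR, hs⟩
    have hp := ha.properties
    refine ⟨⟨l, fun e he => (hp.1 e he).2.1, fun e he => ?_, hs, hp.2.2⟩,
      ⟨⟨fun e he => (hp.1 e he).2.2, hp.2.1, fun e _ hM => ?_⟩, ?_⟩, rfl⟩
    · have := (hp.1 e he).1
      omega
    · exact absurd hM (by simp)
    · intro e he
      cases l with
      | nil => simp at he
      | cons f l =>
        obtain rfl : f = e := by simpa using he
        exact (head_bound_iff k r N f).2 (by simpa only [Reaches, front] using hR)

theorem ncard_boundedColorSet (k r N n : ℕ) (hr : 0 < r) (hrk : r ≤ k) (hN : k ≤ N + r) :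
    (boundedColorSet n k r N).ncard = (reachSet k r N (endHeight k r N) n).ncard := by
  rw [← image_boundedColorSet k r N n hr hrk hN,
    Set.ncard_image_of_injective _ fun p q h => ColorPartition.ext h]

theorem le_of_mem_boundedColorSet {k r N n : ℕ} {p : ColorPartition ((2 * k + 1) / 2 - 1) n}
    (hp : p ∈ boundedColorSet n k r N) {e : ℕ × ℕ} (he : e ∈ p.entries.head?) :
    (e.1 : ℤ) ≤ (N : ℤ) - 1 := by
  have := (head_bound_iff k r N e).1 (hp.2 e he)
  omega

/-! ### The recurrence for the number of admissible lists -/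

/-- The third set holds the lists with apex (N, b). The color is b / 2, and 2 ≤ b ≤ 2k - 1 says that
it lies in {1, …, k - 1}. -/
theorem reachSet_union {k r N : ℕ} {b : ℤ} (n : ℕ) (hb : 2 ≤ b) (hbk : b ≤ 2 * k - 1)
    (hpar : b % 2 = ((N : ℤ) + 1 + r) % 2) :
    reachSet k r (N + 1) b n = (reachSet k r N (b - 1) n ∪ reachSet k r N (b + 1) n) ∪
      {l | ∃ l', l = (N, (b / 2).toNat) :: l' ∧ N ≤ n ∧ l' ∈ reachSet k r (N - 1) b (n - N)} := by
  ext l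
  have hp := front_parity r l
  constructor
  · rintro ⟨ha, hR, hs⟩
    by_cases hx : (front r l).1 = N ∧ (front r l).2 = b
    · right
      cases l with
      | nil => simp only [front] at hx; omega
      | cons e l =>
        have he := height_cases r e
        simp only [front] at hx
        refine ⟨l, ?_, ?_, ha.2.2, ?_, ?_⟩
        · congr 1
          ext <;> simp only <;> omega
        · simp only [List.map_cons, List.sum_cons] at hs
          omega
        · have := ha.2.1
          rwa [hx.1, hx.2] at this
        · simp only [List.map_cons, List.sum_cons] at hs
          omega
    · left
      unfold Reaches at hR
      have : Reaches r N (b - 1) l ∨ Reaches r N (b + 1) l := by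
        unfold Reaches
        omega
      exact this.imp (fun h => ⟨ha, h, hs⟩) (fun h => ⟨ha, h, hs⟩)
  · rintro ((⟨ha, hR, hs⟩ | ⟨ha, hR, hs⟩) | ⟨l', rfl, hn, ha, hR, hs⟩)
    · refine ⟨ha, ?_, hs⟩
      unfold Reaches at hR ⊢
      omega
    · refine ⟨ha, ?_, hs⟩
      unfold Reaches at hR ⊢
      omega
    · have hh : height r (N, (b / 2).toNat) = b := by
        have := height_cases r (N, (b / 2).toNat)
        simp only at this
        omega
      refine ⟨⟨?_, ?_, ha⟩, ?_, ?_⟩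
      · simp only
        omega
      · rwa [hh]
      · simp only [Reaches, front, hh]
        omega
      · simp only [List.map_cons, List.sum_cons]
        omega

theorem reachSet_inter {k r N : ℕ} {b : ℤ} (n : ℕ) :
    reachSet k r N (b - 1) n ∩ reachSet k r N (b + 1) n = reachSet k r (N - 1) b n := by
  ext l
  constructor
  · rintro ⟨⟨ha, hR, hs⟩, -, hR', -⟩
    refine ⟨ha, ?_, hs⟩
    unfold Reaches at hR hR' ⊢
    omega
  · rintro ⟨ha, hR, hs⟩
    unfold Reaches at hR
    refine ⟨⟨ha, ?_, hs⟩, ha, ?_, hs⟩ <;> unfold Reaches <;> omega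

theorem ncard_reachSet_succ {k r N : ℕ} {b : ℤ} (n : ℕ) (hb : 2 ≤ b) (hbk : b ≤ 2 * k - 1)
    (hpar : b % 2 = ((N : ℤ) + 1 + r) % 2) :
    (reachSet k r (N + 1) b n).ncard + (reachSet k r (N - 1) b n).ncard =
      (reachSet k r N (b - 1) n).ncard + (reachSet k r N (b + 1) n).ncard +
        if N ≤ n then (reachSet k r (N - 1) b (n - N)).ncard else 0 := by
  have h3 : {l | ∃ l', l = (N, (b / 2).toNat) :: l' ∧ N ≤ n ∧
      l' ∈ reachSet k r (N - 1) b (n - N)} =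
      if N ≤ n then List.cons (N, (b / 2).toNat) '' reachSet k r (N - 1) b (n - N) else ∅ := by
    split_ifs with h
    · ext l
      simp [h, eq_comm, and_comm]
    · simp [h]
  have h4 : {l | ∃ l', l = (N, (b / 2).toNat) :: l' ∧ N ≤ n ∧
      l' ∈ reachSet k r (N - 1) b (n - N)}.ncard =
      if N ≤ n then (reachSet k r (N - 1) b (n - N)).ncard else 0 := by
    rw [h3]
    split_ifs
    · exact Set.ncard_image_of_injective _ (List.cons_injective)
    · simp
  rw [reachSet_union n hb hbk hpar, Set.ncard_union_eq ?_
    ((finite_reachSet _ _ _ _ _).union (finite_reachSet _ _ _ _ _)) ?_, h4]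
  · have := Set.ncard_union_add_ncard_inter (reachSet k r N (b - 1) n)
      (reachSet k r N (b + 1) n) (finite_reachSet _ _ _ _ _) (finite_reachSet _ _ _ _ _)
    rw [reachSet_inter] at this
    omega
  · rw [Set.disjoint_left]
    rintro _ (h | h) ⟨l', rfl, -⟩ <;>
    · have := h.2.1
      simp only [Reaches, front] at this
      omega
  · rw [h3]
    split_ifs
    · exact (finite_reachSet _ _ _ _ _).image _
    · simp

/-- Only the start point can have height 1; then r = 1, and parity makes N odd, hence positive. -/
theorem reachSet_one {k r N : ℕ} (n : ℕ) (hr : 0 < r) (hpar : ((N : ℤ) + r) % 2 = 0) :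
    reachSet k r (N + 1) 1 n = reachSet k r N 2 n := by
  ext l
  refine and_congr_right fun ha => and_congr_left fun _ => ?_
  have hb := ha.front_bounds
  have hp := front_parity r l
  unfold Reaches
  omega

theorem reachSet_top {k r N : ℕ} (n : ℕ) (hr : 0 < r) (hrk : r ≤ k)
    (hpar : ((N : ℤ) + r) % 2 = 1) :
    reachSet k r (N + 1) (2 * k) n = reachSet k r N (2 * k - 1) n := by
  ext l
  refine and_congr_right fun ha => and_congr_left fun _ => ?_
  have hb := ha.front_bounds
  have hp := front_parity r l
  unfold Reaches
  omega

theorem reachSet_neg (k r : ℕ) {N : ℤ} (hN : N < 0) (b : ℤ) (n : ℕ) :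
    reachSet k r N b n = ∅ := by
  refine Set.eq_empty_of_forall_notMem fun l hl => ?_
  have h := hl.2.1
  have := neg_one_le_front r l
  unfold Reaches at h
  omega

theorem ncard_reachSet_zero (k r : ℕ) (b : ℤ) (n : ℕ) :
    (reachSet k r 0 b n).ncard = if b = r ∧ n = 0 then 1 else 0 := by
  have h : reachSet k r 0 b n = if b = r ∧ n = 0 then {[]} else ∅ := by
    ext l
    cases l with
    | nil =>
      have : ([] : List (ℕ × ℕ)) ∈ reachSet k r 0 b n ↔ b = r ∧ n = 0 := by
        change True ∧ ((r : ℤ) - b ≤ 0 - 1 - -1 ∧ b - r ≤ 0 - 1 - -1) ∧ 0 = n ↔ b = r ∧ n = 0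
        rw [true_and]
        omega
      split_ifs with h
      · simpa using this.2 h
      · simpa using fun h' => h (this.1 h')
    | cons e l =>
      have : e :: l ∉ reachSet k r 0 b n := by
        rintro ⟨-, h, -⟩
        simp only [Reaches, front] at h
        omega
      split_ifs <;> simp [this]
  rw [h]
  split_ifs <;> simp

/-! ### Recurrences for Gaussian binomial coefficients -/

theorem gauss_zero_right (n : ℕ) : gauss n 0 = 1 := by
  cases n <;> rw [gauss]

theorem gauss_succ_succ (n m : ℕ) :
    gauss (n + 1) (m + 1) = gauss n m + X ^ (m + 1) * gauss n (m + 1) := by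
  rw [gauss]

theorem gauss_succ_succ' : ∀ n m : ℕ, m ≤ n →
    gauss (n + 1) (m + 1) = X ^ (n - m) * gauss n m + gauss n (m + 1)
  | 0, m, h => by
    obtain rfl : m = 0 := by omega
    simp [gauss]
  | n + 1, 0, _ => by
    have h1 := gauss_succ_succ (n + 1) 0
    have h2 := gauss_succ_succ n 0
    have ih := gauss_succ_succ' n 0 (by omega)
    simp only [gauss_zero_right, Nat.sub_zero] at h1 h2 ih ⊢
    linear_combination h1 - h2 + X * ih
  | n + 1, m + 1, h => by
    have h1 := gauss_succ_succ (n + 1) (m + 1)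
    rcases Nat.lt_or_ge n (m + 1) with hlt | hle
    · obtain rfl : m = n := by omega
      rw [gauss_self, gauss_self, gauss_eq_zero_of_lt (m + 1) (m + 1 + 1) (by omega)]
      simp
    · have h2 := gauss_succ_succ n m
      have h3 := gauss_succ_succ n (m + 1)
      have ih := gauss_succ_succ' n m (by omega)
      have ih' := gauss_succ_succ' n (m + 1) hle
      have e : n - m = n - (m + 1) + 1 := by omega
      rw [Nat.add_sub_add_right, h1]
      rw [e] at ih ⊢
      linear_combination ih + X ^ (m + 1 + 1) * ih' - X ^ (n - (m + 1) + 1) * h2 - h3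

theorem gaussInt_of_neg (N : ℕ) {m : ℤ} (h : m < 0) : gaussInt N m = 0 := by
  simp [gaussInt, h]

theorem gaussInt_of_lt (N : ℕ) {m : ℤ} (h : (N : ℤ) < m) : gaussInt N m = 0 := by
  unfold gaussInt
  split_ifs
  · exact gauss_eq_zero_of_lt _ _ (by omega)
  · rfl

theorem gaussInt_natCast (N m : ℕ) : gaussInt N m = gauss N m := by
  simp [gaussInt]

theorem gaussInt_zero (m : ℤ) : gaussInt 0 m = if m = 0 then 1 else 0 := by
  split_ifs with h
  · subst h
    simp [gaussInt, gauss]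
  · rcases lt_or_gt_of_ne h with h | h
    · exact gaussInt_of_neg _ h
    · exact gaussInt_of_lt _ (by simpa using h)

theorem gaussInt_succ (N : ℕ) (m : ℤ) :
    gaussInt (N + 1) m = gaussInt N (m - 1) + X ^ m.toNat * gaussInt N m := by
  rcases lt_trichotomy m 0 with h | rfl | h
  · rw [gaussInt_of_neg _ h, gaussInt_of_neg _ h, gaussInt_of_neg _ (by omega)]
    simp
  · simp [gaussInt, gauss]
  · obtain ⟨s, rfl⟩ : ∃ s : ℕ, m = (s + 1 : ℕ) := ⟨(m - 1).toNat, by omega⟩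
    have e : ((s + 1 : ℕ) : ℤ) - 1 = s := by push_cast; ring
    rw [e, gaussInt_natCast, gaussInt_natCast, gaussInt_natCast, gauss, Int.toNat_natCast]

theorem gaussInt_succ' (N : ℕ) (m : ℤ) :
    gaussInt (N + 1) m = X ^ (N + 1 - m).toNat * gaussInt N (m - 1) + gaussInt N m := by
  rcases lt_trichotomy m 0 with h | rfl | h
  · rw [gaussInt_of_neg _ h, gaussInt_of_neg _ h, gaussInt_of_neg _ (by omega)]
    simp
  · simp [gaussInt, gauss]
  · rcases lt_or_ge ((N : ℤ) + 1) m with h' | h'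
    · rw [gaussInt_of_lt _ (by push_cast; omega), gaussInt_of_lt _ (by omega),
        gaussInt_of_lt _ (by omega)]
      simp
    · obtain ⟨s, rfl⟩ : ∃ s : ℕ, m = (s + 1 : ℕ) := ⟨(m - 1).toNat, by omega⟩
      have e : ((s + 1 : ℕ) : ℤ) - 1 = s := by push_cast; ring
      have e' : ((N : ℤ) + 1 - (s + 1 : ℕ)).toNat = N - s := by omega
      rw [e, e', gaussInt_natCast, gaussInt_natCast, gaussInt_natCast,
        gauss_succ_succ' _ _ (by omega)]

/-- Obtained by combining the two q-Pascal rules; this is the termwise form of the recurrence for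
admissible lists. -/
theorem gaussInt_add_two (N : ℕ) (m : ℤ) :
    gaussInt (N + 2) m =
      gaussInt (N + 1) (m - 1) + gaussInt (N + 1) m + (X ^ (N + 1) - 1) * gaussInt N (m - 1) := by
  have h1 := gaussInt_succ (N + 1) m
  have h2 := gaussInt_succ' N m
  have h3 := gaussInt_succ N m
  -- The truncated exponents add up to N + 1 only where the Gaussian binomial can be nonzero.
  have h4 : X ^ m.toNat * (X ^ (N + 1 - m).toNat * gaussInt N (m - 1)) =
      X ^ (N + 1) * gaussInt N (m - 1) := by
    by_cases hm : 0 ≤ m - 1 ∧ m - 1 ≤ N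
    · rw [← mul_assoc, ← pow_add]
      congr 2
      omega
    · have : gaussInt N (m - 1) = 0 := by
        rcases lt_or_ge (m - 1) 0 with h | h
        · exact gaussInt_of_neg _ h
        · exact gaussInt_of_lt _ (by omega)
      simp [this]
  rw [h1]
  linear_combination X ^ m.toNat * h2 + h4 - h3

theorem gaussInt_one (m : ℤ) : gaussInt 1 m = gaussInt 0 (m - 1) + gaussInt 0 m := by
  rw [gaussInt_succ' 0 m, gaussInt_zero (m - 1)]
  split_ifs with h
  · obtain rfl : m = 1 := by omega
    simp
  · simp

/-! ### The bosonic sums for paths in a strip -/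

theorem expo_sub (k r : ℕ) (j : ℤ) : expo k r j - expo k r (j - 1) = (2 * k + 1) * j - r := by
  obtain ⟨a, ha⟩ := two_dvd_expo k r j
  obtain ⟨b, hb⟩ := two_dvd_expo k r (j - 1)
  have h : 2 * (a - b) = 2 * ((2 * k + 1) * j - r) := by linear_combination hb - ha
  unfold expo
  rw [ha, hb, Int.mul_ediv_cancel_left _ (by norm_num), Int.mul_ediv_cancel_left _ (by norm_num)]
  omega

/-- The lower entry of the Gaussian binomial coefficient of index `j`, for the end point `b`. -/
def stripIndex (k r N : ℕ) (b j : ℤ) : ℤ :=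
  if Even j then (N + r - b) / 2 - (2 * k + 1) * (j / 2)
  else (N + r + b) / 2 - (2 * k + 1) * (j / 2 + 1)

theorem stripIndex_two_mul (k r N : ℕ) (b i : ℤ) :
    stripIndex k r N b (2 * i) = (N + r - b) / 2 - (2 * k + 1) * i := by
  simp [stripIndex]

theorem stripIndex_two_mul_add_one (k r N : ℕ) (b i : ℤ) :
    stripIndex k r N b (2 * i + 1) = (N + r + b) / 2 - (2 * k + 1) * (i + 1) := by
  have e : (2 * i + 1) / 2 = i := by omega
  rw [stripIndex, if_neg (by simp), e]

/-- The term of index `j` of the bosonic sum for the end point `b`. -/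
noncomputable def stripTerm (k r N : ℕ) (b j : ℤ) : ℤ[X] :=
  C (j.negOnePow : ℤ) * X ^ (expo k r j).toNat * gaussInt N (stripIndex k r N b j)

/-- The bosonic sum for paths of length `N` from `r` to `b` in the strip `{1, …, 2k}`. -/
noncomputable def stripSum (k r N : ℕ) (b : ℤ) : ℤ[X] := ∑ᶠ j : ℤ, stripTerm k r N b j

theorem stripTerm_support_finite (k r N : ℕ) (b : ℤ) :
    (Function.support (stripTerm k r N b)).Finite := by
  have key : ∀ i s : ℤ, 0 ≤ s - (2 * k + 1) * i → s - (2 * k + 1) * i ≤ N →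
      -(|s| + N) ≤ i ∧ i ≤ |s| + N := by
    intro i s h1 h2
    have h0 : (0 : ℤ) ≤ k := Int.natCast_nonneg k
    have hs := abs_le.1 (le_refl |s|)
    constructor
    · by_contra h
      have : (2 * k + 1) * i ≤ i := by nlinarith
      omega
    · by_contra h
      have : i ≤ (2 * k + 1) * i := by nlinarith
      omega
  set S := |((N : ℤ) + r - b) / 2| + |((N : ℤ) + r + b) / 2| + N
  refine (Set.finite_Icc (-(2 * S + 2)) (2 * S + 2)).subset fun j hj => ?_
  have hm : 0 ≤ stripIndex k r N b j ∧ stripIndex k r N b j ≤ N := by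
    by_contra hc
    refine hj ?_
    have : gaussInt N (stripIndex k r N b j) = 0 := by
      rcases lt_or_ge (stripIndex k r N b j) 0 with h | h
      · exact gaussInt_of_neg _ h
      · exact gaussInt_of_lt _ (by omega)
    simp [stripTerm, this]
  have h1 := abs_nonneg (((N : ℤ) + r - b) / 2)
  have h2 := abs_nonneg (((N : ℤ) + r + b) / 2)
  rw [Set.mem_Icc]
  obtain ⟨i, rfl | rfl⟩ := Int.even_or_odd' j
  · rw [stripIndex_two_mul] at hm
    have := key _ _ hm.1 hm.2
    omega
  · rw [stripIndex_two_mul_add_one] at hm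
    have := key _ _ hm.1 hm.2
    omega

theorem stripSum_add_two (k r N : ℕ) (b : ℤ) (hpar : b % 2 = ((N : ℤ) + r) % 2) :
    stripSum k r (N + 2) b = stripSum k r (N + 1) (b - 1) + stripSum k r (N + 1) (b + 1) +
      (X ^ (N + 1) - 1) * stripSum k r N b := by
  have hf := stripTerm_support_finite k r
  unfold stripSum
  rw [← finsum_add_distrib (hf _ _) (hf _ _), mul_finsum, ← finsum_add_distrib]
  · refine finsum_congr fun j => ?_
    unfold stripTerm
    obtain ⟨i, rfl | rfl⟩ := Int.even_or_odd' j
    · simp only [stripIndex_two_mul]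
      rw [gaussInt_add_two]
      have e1 : (((N + 2 : ℕ) : ℤ) + r - b) / 2 - (2 * k + 1) * i =
        (((N + 1 : ℕ) : ℤ) + r - (b - 1)) / 2 - (2 * k + 1) * i := by omega
      have e2 : (((N + 2 : ℕ) : ℤ) + r - b) / 2 - (2 * k + 1) * i - 1 =
        (((N + 1 : ℕ) : ℤ) + r - (b + 1)) / 2 - (2 * k + 1) * i := by omega
      have e3 : (((N + 2 : ℕ) : ℤ) + r - b) / 2 - (2 * k + 1) * i - 1 =
        ((N : ℤ) + r - b) / 2 - (2 * k + 1) * i := by omega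
      rw [← e1, ← e2, ← e3]
      ring
    · simp only [stripIndex_two_mul_add_one]
      rw [gaussInt_add_two]
      have e1 : (((N + 2 : ℕ) : ℤ) + r + b) / 2 - (2 * k + 1) * (i + 1) =
        (((N + 1 : ℕ) : ℤ) + r + (b + 1)) / 2 - (2 * k + 1) * (i + 1) := by omega
      have e2 : (((N + 2 : ℕ) : ℤ) + r + b) / 2 - (2 * k + 1) * (i + 1) - 1 =
        (((N + 1 : ℕ) : ℤ) + r + (b - 1)) / 2 - (2 * k + 1) * (i + 1) := by omega
      have e3 : (((N + 2 : ℕ) : ℤ) + r + b) / 2 - (2 * k + 1) * (i + 1) - 1 =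
        ((N : ℤ) + r + b) / 2 - (2 * k + 1) * (i + 1) := by omega
      rw [← e1, ← e2, ← e3]
      ring
  · exact ((hf _ _).union (hf _ _)).subset (Function.support_add _ _)
  · exact (hf N b).subset (Function.support_mul_subset_right _ _)

theorem stripSum_one_length (k r : ℕ) (b : ℤ) (hpar : b % 2 = ((r : ℤ) + 1) % 2) :
    stripSum k r 1 b = stripSum k r 0 (b - 1) + stripSum k r 0 (b + 1) := by
  have hf := stripTerm_support_finite k r
  unfold stripSum
  rw [← finsum_add_distrib (hf _ _) (hf _ _)]
  refine finsum_congr fun j => ?_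
  unfold stripTerm
  rw [gaussInt_one]
  obtain ⟨i, rfl | rfl⟩ := Int.even_or_odd' j
  · simp only [stripIndex_two_mul]
    have e1 : (((1 : ℕ) : ℤ) + r - b) / 2 - (2 * k + 1) * i =
      (((0 : ℕ) : ℤ) + r - (b - 1)) / 2 - (2 * k + 1) * i := by omega
    have e2 : (((1 : ℕ) : ℤ) + r - b) / 2 - (2 * k + 1) * i - 1 =
      (((0 : ℕ) : ℤ) + r - (b + 1)) / 2 - (2 * k + 1) * i := by omega
    rw [← e1, ← e2]
    ring
  · simp only [stripIndex_two_mul_add_one]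
    have e1 : (((1 : ℕ) : ℤ) + r + b) / 2 - (2 * k + 1) * (i + 1) =
      (((0 : ℕ) : ℤ) + r + (b + 1)) / 2 - (2 * k + 1) * (i + 1) := by omega
    have e2 : (((1 : ℕ) : ℤ) + r + b) / 2 - (2 * k + 1) * (i + 1) - 1 =
      (((0 : ℕ) : ℤ) + r + (b - 1)) / 2 - (2 * k + 1) * (i + 1) := by omega
    rw [← e1, ← e2]
    ring

/-- For j ≠ 0 the images of b under the reflections and translations avoid r, so the lower index is
never 0. -/
theorem stripSum_zero_length (k r : ℕ) (b : ℤ) (hr : 0 < r) (hrk : r ≤ k) (hb : 1 ≤ b)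
    (hbk : b ≤ 2 * k) (hpar : b % 2 = (r : ℤ) % 2) :
    stripSum k r 0 b = if b = r then 1 else 0 := by
  have h0 : ∀ j : ℤ, j ≠ 0 → stripTerm k r 0 b j = 0 := by
    intro j hj
    unfold stripTerm
    rw [gaussInt_zero, if_neg, mul_zero]
    intro h
    obtain ⟨i, rfl | rfl⟩ := Int.even_or_odd' j
    · rw [stripIndex_two_mul] at h
      rcases lt_trichotomy i 0 with hi | hi | hi
      · have : (2 * (k : ℤ) + 1) * i ≤ -(2 * k + 1) := by nlinarith
        omega
      · omega
      · have : (2 * (k : ℤ) + 1) ≤ (2 * k + 1) * i := by nlinarith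
        omega
    · rw [stripIndex_two_mul_add_one] at h
      rcases lt_or_ge i 0 with hi | hi
      · have : (2 * (k : ℤ) + 1) * (i + 1) ≤ 0 := by nlinarith
        omega
      · have : (2 * (k : ℤ) + 1) ≤ (2 * k + 1) * (i + 1) := by nlinarith
        omega
  rw [stripSum, finsum_eq_single _ 0 h0, stripTerm, gaussInt_zero]
  have e := stripIndex_two_mul k r 0 b 0
  rw [mul_zero] at e
  rw [e]
  have hc : ((0 : ℕ) + (r : ℤ) - b) / 2 - (2 * k + 1) * 0 = 0 ↔ b = r := by omega
  simp only [hc, expo]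
  split_ifs <;> simp

/-! ### Wall identities by a sign-reversing pairing -/

theorem finsum_eq_zero_of_neg {f : ℤ → ℤ[X]} (σ : ℤ ≃ ℤ) (h : ∀ i, f (σ i) = -f i) :
    ∑ᶠ i, f i = 0 := by
  have h1 : ∑ᶠ i, f (σ i) = ∑ᶠ i, f i := finsum_comp_equiv σ
  simp only [h, finsum_neg_distrib] at h1
  exact self_eq_neg.1 h1.symm

/-- Exchanges `2i` and `2i + 1`. -/
def swapUp : ℤ ≃ ℤ where
  toFun j := if j % 2 = 0 then j + 1 else j - 1
  invFun j := if j % 2 = 0 then j + 1 else j - 1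
  left_inv j := by dsimp only; split_ifs <;> omega
  right_inv j := by dsimp only; split_ifs <;> omega

/-- Exchanges `2i` and `2i - 1`. -/
def swapDown : ℤ ≃ ℤ where
  toFun j := if j % 2 = 0 then j - 1 else j + 1
  invFun j := if j % 2 = 0 then j - 1 else j + 1
  left_inv j := by dsimp only; split_ifs <;> omega
  right_inv j := by dsimp only; split_ifs <;> omega

theorem X_pow_mul_gaussInt (k r N : ℕ) (hrk : r ≤ k) {i j a b m : ℤ}
    (h : 0 ≤ m → m ≤ N → 0 ≤ a ∧ 0 ≤ b ∧ expo k r i + a = expo k r j + b) :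
    (X : ℤ[X]) ^ (expo k r i).toNat * (X ^ a.toNat * gaussInt N m) =
      X ^ (expo k r j).toNat * (X ^ b.toNat * gaussInt N m) := by
  by_cases hm : 0 ≤ m ∧ m ≤ N
  · have h1 := h hm.1 hm.2
    have h2 := expo_nonneg k r hrk i
    have h3 := expo_nonneg k r hrk j
    rw [← mul_assoc, ← mul_assoc, ← pow_add, ← pow_add]
    congr 2
    omega
  · have : gaussInt N m = 0 := by
      rcases lt_or_ge m 0 with h | h
      · exact gaussInt_of_neg _ h
      · exact gaussInt_of_lt _ (by omega)
    simp [this]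

/-- Reflection in the wall 0 pairs 2i with 2i - 1. By opposite q-Pascal rules both differences
become powers of q times the same [N choose m], and `expo_sub` equates the powers. -/
theorem stripSum_one (k r N : ℕ) (hrk : r ≤ k) (hpar : ((N : ℤ) + r) % 2 = 0) :
    stripSum k r (N + 1) 1 = stripSum k r N 2 := by
  have hf := stripTerm_support_finite k r
  rw [← sub_eq_zero, stripSum, stripSum, ← finsum_sub_distrib (hf _ _) (hf _ _)]
  have key : ∀ i : ℤ,
      stripTerm k r (N + 1) 1 (2 * i - 1) - stripTerm k r N 2 (2 * i - 1) =
        -(stripTerm k r (N + 1) 1 (2 * i) - stripTerm k r N 2 (2 * i)) := by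
    intro i
    have e0 : 2 * i - 1 = 2 * (i - 1) + 1 := by ring
    have hx := expo_sub k r (2 * i)
    have hX := X_pow_mul_gaussInt k r N hrk (i := 2 * i) (j := 2 * i - 1)
      (m := stripIndex k r (N + 1) 1 (2 * i)) (a := stripIndex k r (N + 1) 1 (2 * i))
      (b := N - stripIndex k r (N + 1) 1 (2 * i)) (fun h1 h2 => ⟨h1, by omega, by
        rw [stripIndex_two_mul]
        have : (2 * (k : ℤ) + 1) * (2 * i) = 2 * ((2 * k + 1) * i) := by ring
        omega⟩)
    unfold stripTerm
    rw [gaussInt_succ N (stripIndex k r (N + 1) 1 (2 * i)),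
      gaussInt_succ' N (stripIndex k r (N + 1) 1 (2 * i - 1))]
    have e1 : stripIndex k r (N + 1) 1 (2 * i - 1) = stripIndex k r N 2 (2 * i - 1) := by
      rw [e0, stripIndex_two_mul_add_one, stripIndex_two_mul_add_one]
      omega
    have e2 : stripIndex k r (N + 1) 1 (2 * i) - 1 = stripIndex k r N 2 (2 * i) := by
      rw [stripIndex_two_mul, stripIndex_two_mul]
      omega
    have e3 : stripIndex k r (N + 1) 1 (2 * i - 1) - 1 = stripIndex k r (N + 1) 1 (2 * i) := by
      rw [e0, stripIndex_two_mul_add_one, stripIndex_two_mul, sub_add_cancel]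
      omega
    have e4 : (N : ℤ) + 1 - stripIndex k r (N + 1) 1 (2 * i - 1) =
        N - stripIndex k r (N + 1) 1 (2 * i) := by omega
    rw [e3, e4, e1, e2]
    have s1 : (2 * i).negOnePow = 1 := Int.negOnePow_even _ (by simp)
    have s2 : (2 * i - 1).negOnePow = -1 := Int.negOnePow_odd _ (by rw [e0]; simp)
    rw [s1, s2]
    simp only [Units.val_one, Units.val_neg, C_neg, C_1]
    linear_combination hX
  refine finsum_eq_zero_of_neg swapDown fun j => ?_
  obtain ⟨i, rfl | rfl⟩ := Int.even_or_odd' j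
  · have e : swapDown (2 * i) = 2 * i - 1 := by simp [swapDown]
    rw [e, key]
  · have e : swapDown (2 * i + 1) = 2 * (i + 1) := by
      simp only [swapDown, Equiv.coe_fn_mk]
      omega
    have e' : 2 * i + 1 = 2 * (i + 1) - 1 := by ring
    rw [e, e', key, neg_neg]

/-- The same cancellation at the wall 2k + 1, which pairs 2i with 2i + 1. -/
theorem stripSum_top (k r N : ℕ) (hrk : r ≤ k) (hpar : ((N : ℤ) + r) % 2 = 1) :
    stripSum k r (N + 1) (2 * k) = stripSum k r N (2 * k - 1) := by
  have hf := stripTerm_support_finite k r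
  rw [← sub_eq_zero, stripSum, stripSum, ← finsum_sub_distrib (hf _ _) (hf _ _)]
  have key : ∀ i : ℤ,
      stripTerm k r (N + 1) (2 * k) (2 * i + 1) - stripTerm k r N (2 * k - 1) (2 * i + 1) =
        -(stripTerm k r (N + 1) (2 * k) (2 * i) - stripTerm k r N (2 * k - 1) (2 * i)) := by
    intro i
    have hx := expo_sub k r (2 * i + 1)
    rw [add_sub_cancel_right] at hx
    have e3 : stripIndex k r (N + 1) (2 * k) (2 * i) - 1 =
        stripIndex k r (N + 1) (2 * k) (2 * i + 1) := by
      rw [stripIndex_two_mul_add_one, stripIndex_two_mul]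
      have : (2 * (k : ℤ) + 1) * (i + 1) = (2 * k + 1) * i + 2 * k + 1 := by ring
      omega
    have hX := X_pow_mul_gaussInt k r N hrk (i := 2 * i + 1) (j := 2 * i)
      (m := stripIndex k r (N + 1) (2 * k) (2 * i + 1))
      (a := stripIndex k r (N + 1) (2 * k) (2 * i + 1))
      (b := N - stripIndex k r (N + 1) (2 * k) (2 * i + 1)) (fun h1 h2 => ⟨h1, by omega, by
        rw [← e3, stripIndex_two_mul]
        have : (2 * (k : ℤ) + 1) * (2 * i + 1) = 2 * ((2 * k + 1) * i) + 2 * k + 1 := by ring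
        omega⟩)
    unfold stripTerm
    rw [gaussInt_succ N (stripIndex k r (N + 1) (2 * k) (2 * i + 1)),
      gaussInt_succ' N (stripIndex k r (N + 1) (2 * k) (2 * i))]
    have e1 : stripIndex k r (N + 1) (2 * k) (2 * i) = stripIndex k r N (2 * k - 1) (2 * i) := by
      rw [stripIndex_two_mul, stripIndex_two_mul]
      omega
    have e2 : stripIndex k r (N + 1) (2 * k) (2 * i + 1) - 1 =
        stripIndex k r N (2 * k - 1) (2 * i + 1) := by
      rw [stripIndex_two_mul_add_one, stripIndex_two_mul_add_one]
      omega
    have e4 : (N : ℤ) + 1 - stripIndex k r (N + 1) (2 * k) (2 * i) =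
        N - stripIndex k r (N + 1) (2 * k) (2 * i + 1) := by omega
    rw [e3, e4, e1, e2]
    have s1 : (2 * i).negOnePow = 1 := Int.negOnePow_even _ (by simp)
    have s2 : (2 * i + 1).negOnePow = -1 := Int.negOnePow_odd _ (by simp)
    rw [s1, s2]
    simp only [Units.val_one, Units.val_neg, C_neg, C_1]
    linear_combination -hX
  refine finsum_eq_zero_of_neg swapUp fun j => ?_
  obtain ⟨i, rfl | rfl⟩ := Int.even_or_odd' j
  · have e : swapUp (2 * i) = 2 * i + 1 := by simp [swapUp]
    rw [e, key]
  · have e : swapUp (2 * i + 1) = 2 * i := by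
      simp only [swapUp, Equiv.coe_fn_mk]
      omega
    rw [e, key, neg_neg]

/-! ### Comparison of the two sides -/

/-- The central reflection b ↦ 2k + 1 - b exchanges k and k + 1, so at these heights a single floor
expression covers even and odd j. -/
theorem bosonicSum_eq_stripSum (k r N : ℕ) :
    bosonicSum k r N = stripSum k r N (endHeight k r N) := by
  refine finsum_congr fun j => ?_
  unfold bosonicTerm stripTerm
  congr 2
  have h := endHeight_cases k r N
  obtain ⟨i, rfl | rfl⟩ := Int.even_or_odd' j
  · rw [stripIndex_two_mul]
    have : (2 * (k : ℤ) + 1) * (2 * i) = 2 * ((2 * k + 1) * i) := by ring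
    omega
  · rw [stripIndex_two_mul_add_one]
    have : (2 * (k : ℤ) + 1) * (2 * i + 1) = 2 * ((2 * k + 1) * i) + 2 * k + 1 := by ring
    have : (2 * (k : ℤ) + 1) * (i + 1) = (2 * k + 1) * i + 2 * k + 1 := by ring
    omega

theorem coeff_stripSum (k r : ℕ) (hr : 0 < r) (hrk : r ≤ k) : ∀ (N : ℕ) (b : ℤ) (n : ℕ), 1 ≤ b →
    b ≤ 2 * k → b % 2 = ((N : ℤ) + r) % 2 →
    (stripSum k r N b).coeff n = ((reachSet k r N b n).ncard : ℤ)
  | 0, b, n, hb, hbk, hpar => by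
    rw [stripSum_zero_length k r b hr hrk hb hbk (by simpa using hpar), Nat.cast_zero,
      ncard_reachSet_zero]
    by_cases h : b = r <;> simp [h, coeff_one]
  | N + 1, b, n, hb, hbk, hpar => by
    rcases eq_or_lt_of_le hb with rfl | hb
    · have ih := coeff_stripSum k r hr hrk N 2 n (by omega) (by omega) (by omega)
      rw [stripSum_one k r N hrk (by omega), ih, Nat.cast_succ, reachSet_one n hr (by omega)]
    rcases eq_or_lt_of_le hbk with rfl | hbk
    · have ih := coeff_stripSum k r hr hrk N (2 * k - 1) n (by omega) (by omega) (by omega)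
      rw [stripSum_top k r N hrk (by omega), ih, Nat.cast_succ, reachSet_top n hr hrk (by omega)]
    have ih1 := coeff_stripSum k r hr hrk N (b - 1) n (by omega) (by omega) (by omega)
    have ih2 := coeff_stripSum k r hr hrk N (b + 1) n (by omega) (by omega) (by omega)
    have hrec := ncard_reachSet_succ (k := k) (r := r) (N := N) n hb (by omega) (by omega)
    cases N with
    | zero =>
      -- For length 1 the recurrence refers to length -1, where no list exists.
      simp only [Nat.cast_zero, zero_sub, reachSet_neg k r neg_one_lt_zero, Set.ncard_empty] at hrec
      rw [stripSum_one_length k r b (by omega), coeff_add, ih1, ih2]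
      simp only [Nat.cast_zero, Nat.cast_succ] at hrec ⊢
      rw [← Nat.cast_add]
      congr 1
      simpa using hrec.symm
    | succ N =>
      have ih3 := fun n => coeff_stripSum k r hr hrk N b n (by omega) (by omega) (by omega)
      rw [Nat.cast_succ (n := N), add_sub_cancel_right] at hrec
      rw [stripSum_add_two k r N b (by omega), sub_mul, one_mul, coeff_add, coeff_add, coeff_sub,
        coeff_X_pow_mul', ih1, ih2, ih3, ih3, Nat.cast_succ (n := N + 1), Nat.cast_succ (n := N)]
      rw [← Nat.cast_inj (R := ℤ)] at hrec
      push_cast at hrec ⊢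
      linear_combination -hrec

end MultiColor

theorem mainTheorem4 (k r N : ℕ) (hr : 0 < r) (hrk : r ≤ k) (hN : k ≤ N + r) :
    ((MultiColor.bosonicSum k r N : ℤ[X]) : ℤ⟦X⟧) =
        PowerSeries.mk (fun n => ((MultiColor.boundedColorSet n k r N).ncard : ℤ)) ∧
      ∀ n : ℕ, ∀ p ∈ MultiColor.boundedColorSet n k r N, ∀ e ∈ p.entries.head?,
        (e.1 : ℤ) ≤ (N : ℤ) - 1 := by
  refine ⟨?_, fun n p hp e he => MultiColor.le_of_mem_boundedColorSet hp he⟩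
  have h := MultiColor.endHeight_cases k r N
  ext n
  rw [Polynomial.coeff_coe, PowerSeries.coeff_mk, MultiColor.bosonicSum_eq_stripSum,
    MultiColor.coeff_stripSum k r hr hrk N _ n (by omega) (by omega) (by omega),
    MultiColor.ncard_boundedColorSet k r N n hr hrk hN]
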